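/- Consider a multirotor UAV of mass $m_{UAV}>0$ with a payload of mass $m_{PL}\ge 0$; let $m_{tot}=m_{UAV}+m_{PL}$, let $H_{tot}=\mathrm{diag}(H_{xx},H_{yy},H_{zz})$ be the total inertia with positive entries, and let $g>0$. The payload and the controlled point lie on the body-fixed vertical axis at signed heights $z_{PL},z_{POI}\in\mathbb R$. Put $\alpha=z_{POI}-\frac{m_{PL}}{m_{tot}}z_{PL}$. For weights $q_1,\dots,q_4>0$ put $$\hat q_1=\frac{m_{PL}m_{UAV}z_{PL}^2+H_{yy}m_{tot}}{m_{tot}}\,q_1,\quad \hat q_2=\frac{m_{PL}m_{UAV}z_{PL}^2+H_{xx}m_{tot}}{m_{tot}}\,q_2,\quad \hat q_3=m_{tot}\,q_3,\quad \hat q_4=H_{zz}\,q_4 .$$ The linearized dynamics decouple into four subsystems $\dot x_i=A_ix_i+B_iu_i$, $y_i=C_ix_i$, where $C_i$ selects the first state, $$A_1=\begin{bmatrix}0&1&0&0\\0&0&g&0\\0&0&0&1\\0&0&0&0\end{bmatrix},\; B_1=\begin{bmatrix}0\\ \alpha\\0\\1\end{bmatrix},\quad A_2=\begin{bmatrix}0&1&0&0\\0&0&-g&0\\0&0&0&1\\0&0&0&0\end{bmatrix},\;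 B_2=\begin{bmatrix}0\\-\alpha\\0\\1\end{bmatrix},\quad A_3=A_4=\begin{bmatrix}0&1\\0&0\end{bmatrix},\; B_3=B_4=\begin{bmatrix}0\\1\end{bmatrix}.$$ For each $i$ the algebraic Riccati equation $A_i^\top P+PA_i-PB_iB_i^\top P+\hat q_i^2C_i^\top C_i=0$ (cost $\int_0^\infty \hat q_i^2y_i^2+u_i^2\,dt$) has exactly one positive semidefinite solution $P_i$. Under the LQR law $u_i=-B_i^\top P_ix_i$ the closed loop $\dot x_i=(A_i-B_iB_i^\top P_i)x_i+B_id$ with disturbance $d$ and performance output $z_i=(\hat q_iy_i,u_i)$ is asymptotically stable (all eigenvalues of $A_i-B_iB_i^\top P_i$ have negative real part). Let $\mathcal H_{2,i}$ be its $\mathcal H_2$-norm, i.e. the $L^2(0,\infty)$-norm of the impulse response from $d$ to $z_i$. Then for $i\in\{1,2\}$ $$\mathcal H_{2,i}^2=\frac{2a_i-b_i+\sigma_i}{\hat q_i\sqrt{\hat q_i}\,\sqrt{a_i-b_i+\sigma_i}},\qquad a_i=\sqrt{2g\hat q_i^7},\quad b_i=\alpha\hat q_i^4,\quad \sigma_i=\sqrt{(a_i-b_i)^2+a_i^2},$$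 and for $i\in\{3,4\}$ $$\mathcal H_{2,i}^2=\sqrt{2\hat q_i}.$$ -/

import Mathlib

open scoped Matrix

noncomputable section

namespace UAVPayload

/-- Physical parameters of a multirotor UAV with a rigidly attached payload. The total inertia is
`diag (Hxx, Hyy, Hzz)`, and the payload and the point of interest lie on the body-fixed vertical
axis through the centre of gravity of the UAV body, at the signed heights `zPL` and `zPOI`.
The numbers `q 0, q 1, q 2, q 3` are the output weights `q₁, q₂, q₃, q₄`. -/
structure Params where
  g : ℝ
  mUAV : ℝ
  mPL : ℝ
  Hxx : ℝ
  Hyy : ℝ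
  Hzz : ℝ
  zPL : ℝ
  zPOI : ℝ
  q : Fin 4 → ℝ
  g_pos : 0 < g
  mUAV_pos : 0 < mUAV
  mPL_nonneg : 0 ≤ mPL
  Hxx_pos : 0 < Hxx
  Hyy_pos : 0 < Hyy
  Hzz_pos : 0 < Hzz
  q_pos : ∀ i, 0 < q i

namespace Params

variable (S : Params)

/-- Total mass. -/
def mtot : ℝ := S.mUAV + S.mPL

/-- Signed height of the point of interest above the total centre of gravity. -/
def alpha : ℝ := S.zPOI - S.mPL / S.mtot * S.zPL

/-- The reciprocals of the diagonal entries of the input scaling, in the order of the subsystems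
`x, y, z, ψ`, so that the scaled weight is this number times the original weight. -/
def inputScale : Fin 4 → ℝ :=
  ![(S.mPL * S.mUAV * S.zPL ^ 2 + S.Hyy * S.mtot) / S.mtot,
    (S.mPL * S.mUAV * S.zPL ^ 2 + S.Hxx * S.mtot) / S.mtot,
    S.mtot,
    S.Hzz]

/-- Scaled output weights `q̂₁, q̂₂, q̂₃, q̂₄`. -/
def qhat (i : Fin 4) : ℝ := S.inputScale i * S.q i

/-- `a_i = √(2 g q̂_i ^ 7)`. -/
def a (i : Fin 4) : ℝ := √(2 * S.g * S.qhat i ^ 7)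

/-- `b_i = α q̂_i ^ 4`. -/
def b (i : Fin 4) : ℝ := S.alpha * S.qhat i ^ 4

/-- `σ_i = √((a_i - b_i)² + a_i²)`. -/
def sigma (i : Fin 4) : ℝ := √((S.a i - S.b i) ^ 2 + S.a i ^ 2)

end Params

/-- A linear time-invariant plant `x' = A x + B u`, `y = C x` with scalar input and output,
together with the weight `w` of the running cost `w² y² + u²`. -/
structure Plant (n : ℕ) where
  A : Matrix (Fin n) (Fin n) ℝ
  B : Matrix (Fin n) (Fin 1) ℝ
  C : Matrix (Fin 1) (Fin n) ℝ
  w : ℝ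

/-- Subsystem 1: state `(x_POI, x_POI', θ, ω_y)`, output `x_POI`. -/
def subsystem1 (S : Params) : Plant 4 where
  A := !![0, 1, 0, 0; 0, 0, S.g, 0; 0, 0, 0, 1; 0, 0, 0, 0]
  B := !![0; S.alpha; 0; 1]
  C := !![1, 0, 0, 0]
  w := S.qhat 0

/-- Subsystem 2: state `(y_POI, y_POI', φ, ω_x)`, output `y_POI`. -/
def subsystem2 (S : Params) : Plant 4 where
  A := !![0, 1, 0, 0; 0, 0, -S.g, 0; 0, 0, 0, 1; 0, 0, 0, 0]
  B := !![0; -S.alpha; 0; 1]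
  C := !![1, 0, 0, 0]
  w := S.qhat 1

/-- Subsystem 3: state `(z_POI, z_POI')`, output `z_POI`. -/
def subsystem3 (S : Params) : Plant 2 where
  A := !![0, 1; 0, 0]
  B := !![0; 1]
  C := !![1, 0]
  w := S.qhat 2

/-- Subsystem 4: state `(ψ, ω_z)`, output `ψ`. -/
def subsystem4 (S : Params) : Plant 2 where
  A := !![0, 1; 0, 0]
  B := !![0; 1]
  C := !![1, 0]
  w := S.qhat 3

/-- All (complex) eigenvalues of the real matrix `A` have negative real part. -/
def IsHurwitz {n : ℕ} (A : Matrix (Fin n) (Fin n) ℝ) : Prop :=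
  ∀ μ ∈ spectrum ℂ (A.map (algebraMap ℝ ℂ)), μ.re < 0

/-- Squared Frobenius norm of the impulse response `C e^{tA} B` of `x' = A x + B d`, `z = C x`. -/
def impulseEnergy {n m p : ℕ} (A : Matrix (Fin n) (Fin n) ℝ) (B : Matrix (Fin n) (Fin m) ℝ)
    (C : Matrix (Fin p) (Fin n) ℝ) (t : ℝ) : ℝ :=
  ((C * NormedSpace.exp (t • A) * B)ᵀ * (C * NormedSpace.exp (t • A) * B)).trace

/-- `h` is the `H₂`-norm of the stable system `x' = A x + B d`, `z = C x`: the matrix `A` is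
Hurwitz and `h` is the `L²`-norm over `[0, ∞)` of the impulse response from `d` to `z`. -/
def HasH2Norm {n m p : ℕ} (A : Matrix (Fin n) (Fin n) ℝ) (B : Matrix (Fin n) (Fin m) ℝ)
    (C : Matrix (Fin p) (Fin n) ℝ) (h : ℝ) : Prop :=
  IsHurwitz A ∧
    MeasureTheory.IntegrableOn (impulseEnergy A B C) (Set.Ioi 0) ∧
    h = √(∫ t in Set.Ioi (0 : ℝ), impulseEnergy A B C t)

namespace Plant

variable {n : ℕ} (G : Plant n)

/-- `P` is a positive semidefinite solution of the algebraic Riccati equation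
`Aᵀ P + P A - P B R⁻¹ Bᵀ P + w² Cᵀ C = 0` with `R = 1`. -/
def IsRiccatiSolution (P : Matrix (Fin n) (Fin n) ℝ) : Prop :=
  P.PosSemidef ∧ G.Aᵀ * P + P * G.A - P * G.B * G.Bᵀ * P + G.w ^ 2 • (G.Cᵀ * G.C) = 0

/-- State matrix `A - B Bᵀ P` of the loop closed by the feedback `u = -Bᵀ P x`. -/
def closedLoopA (P : Matrix (Fin n) (Fin n) ℝ) : Matrix (Fin n) (Fin n) ℝ :=
  G.A - G.B * (G.Bᵀ * P)

/-- Output matrix of the performance output `z = (w y, u)` under the feedback `u = -Bᵀ P x`. -/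
def closedLoopC (P : Matrix (Fin n) (Fin n) ℝ) : Matrix (Fin 2) (Fin n) ℝ :=
  Matrix.of ![(G.w • G.C) 0, (-(G.Bᵀ * P)) 0]

/-- The Riccati equation of `G` has exactly one positive semidefinite solution `P`, and the loop
closed by the LQR law `u = -Bᵀ P x`, with the disturbance entering additively at the input of the
plant and with performance output `z = (w y, u)`, is stable with `H₂`-norm `h`. -/
def HasLQRH2Norm (h : ℝ) : Prop :=
  ∃ P, G.IsRiccatiSolution P ∧ (∀ P', G.IsRiccatiSolution P' → P' = P) ∧
    HasH2Norm (G.closedLoopA P) G.B (G.closedLoopC P) h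

end Plant

end UAVPayload

end

/-!
For every positive semidefinite solution `P` of the Riccati equation the closed loop satisfies the
Lyapunov equation `(A - B Bᵀ P)ᵀ P + P (A - B Bᵀ P) = -(w² Cᵀ C + (Bᵀ P)ᵀ (Bᵀ P))`, whose right-hand
side is minus the Gram matrix of the performance output. As the plant is detectable, the closed loop
is therefore stable, and integrating the Lyapunov equation along it shows that the squared `H₂`-norm
is `tr (Bᵀ P B)`. The difference `D` of two solutions satisfies `A₁ᵀ D + D A₂ = 0` with the two
closed-loop matrices, so that `e^{t A₁ᵀ} D e^{t A₂}` is constant in `t`; as it tends to `0`, the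
solution is unique.

It remains to exhibit one solution. For the horizontal subsystems, with transfer function
`(α s² + γ) / s⁴`, it comes from the stable factor of
`s⁸ + w² (α s² + γ)² = (s⁴ + i κ (α s² + γ)) (s⁴ - i κ (α s² + γ))`, where `κ = ± w` and
`κ γ > 0`: the equation `s⁴ + i κ (α s² + γ) = (s² + c s + d) (s² - c s + d)` is solved by square
roots, and the stable factor is `(s² + c s + d) (s² + c̄ s + d̄)`.
-/

namespace UAVPayload

section BanachAlgebra

open Filter Topology NormedSpace

section Real

variable {𝔸 : Type*} [NormedRing 𝔸] [NormedAlgebra ℝ 𝔸] [CompleteSpace 𝔸] {a b x : 𝔸}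

theorem hasDerivAt_exp_smul_mul_mul_exp_smul (a b x : 𝔸) (t : ℝ) :
    HasDerivAt (fun t : ℝ ↦ exp (t • a) * x * exp (t • b))
      (exp (t • a) * (a * x + x * b) * exp (t • b)) t := by
  refine (((hasDerivAt_exp_smul_const a t).mul_const x).mul
    (hasDerivAt_exp_smul_const' b t)).congr_deriv ?_
  noncomm_ring

theorem eq_zero_of_mul_add_mul_eq_zero_of_tendsto_exp
    (ha : Tendsto (fun t : ℝ ↦ exp (t • a)) atTop (𝓝 0))
    (hb : Tendsto (fun t : ℝ ↦ exp (t • b)) atTop (𝓝 0)) (h : a * x + x * b = 0) : x = 0 := by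
  have hderiv (t : ℝ) : HasDerivAt (fun t : ℝ ↦ exp (t • a) * x * exp (t • b)) 0 t := by
    simpa [h] using hasDerivAt_exp_smul_mul_mul_exp_smul a b x t
  have hconst (t : ℝ) : exp (t • a) * x * exp (t • b) = x := by
    simpa using is_const_of_deriv_eq_zero (fun t ↦ (hderiv t).differentiableAt)
      (fun t ↦ (hderiv t).deriv) t 0
  have hlim := (ha.mul_const x).mul hb
  simp only [hconst, zero_mul] at hlim
  exact tendsto_nhds_unique tendsto_const_nhds hlim

end Real

section Complex

theorem tendsto_exp_mul_mul_pow_of_re_neg {μ : ℂ} (hμ : μ.re < 0) (j : ℕ) :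
    Tendsto (fun t : ℝ ↦ Complex.exp (t * μ) * (t : ℂ) ^ j) atTop (𝓝 0) := by
  have hlim : Tendsto (fun t : ℝ ↦ t ^ j / Real.exp (-μ.re * t)) atTop (𝓝 0) :=
    (isLittleO_pow_exp_pos_mul_atTop j (neg_pos.2 hμ)).tendsto_div_nhds_zero
  refine tendsto_zero_iff_norm_tendsto_zero.2 (hlim.congr' ?_)
  filter_upwards [eventually_ge_atTop 0] with t ht
  rw [norm_mul, norm_pow, Complex.norm_exp, Complex.norm_real, Real.norm_of_nonneg ht,
    Complex.re_ofReal_mul, div_eq_mul_inv, ← Real.exp_neg, mul_comm, neg_mul, neg_neg,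
    mul_comm t μ.re]

variable {𝔸 : Type*} [NormedRing 𝔸] [NormedAlgebra ℂ 𝔸]

theorem exp_mul_eq_sum_of_pow_mul_eq_zero [CompleteSpace 𝔸] {a x : 𝔸} {k : ℕ}
    (h : a ^ k * x = 0) :
    exp a * x = ∑ j ∈ Finset.range k, (j.factorial : ℂ)⁻¹ • (a ^ j * x) := by
  have hseries := (exp_series_hasSum_exp' (𝕂 := ℂ) a).mul_right x
  simp only [smul_mul_assoc] at hseries
  refine hseries.unique (hasSum_sum_of_ne_finset_zero fun j hj ↦ ?_)
  obtain ⟨i, rfl⟩ := Nat.exists_eq_add_of_le' (not_lt.1 (mt Finset.mem_range.2 hj))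
  rw [pow_add, mul_assoc, h, mul_zero, smul_zero]

theorem exp_smul_eq_exp_smul_exp_smul_sub_algebraMap [CompleteSpace 𝔸] (a : 𝔸) (μ t : ℂ) :
    exp (t • a) = Complex.exp (t * μ) • exp (t • (a - algebraMap ℂ 𝔸 μ)) := by
  let _ := NormedAlgebra.restrictScalars ℚ ℂ 𝔸
  have hsplit : t • a = algebraMap ℂ 𝔸 (t * μ) + t • (a - algebraMap ℂ 𝔸 μ) := by
    rw [smul_sub, map_mul, ← Algebra.smul_def, add_sub_cancel]
  rw [hsplit, exp_add_of_commute (Algebra.commutes _ _), ← algebraMap_exp_comm,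
    ← Complex.exp_eq_exp_ℂ, ← Algebra.smul_def]

theorem tendsto_exp_smul_mul_of_pow_sub_algebraMap_mul_eq_zero [CompleteSpace 𝔸] {a x : 𝔸}
    {μ : ℂ} {k : ℕ} (hμ : μ.re < 0) (h : (a - algebraMap ℂ 𝔸 μ) ^ k * x = 0) :
    Tendsto (fun t : ℝ ↦ exp ((t : ℂ) • a) * x) atTop (𝓝 0) := by
  set N := a - algebraMap ℂ 𝔸 μ with hN
  have hexpand (t : ℝ) : exp ((t : ℂ) • a) * x = ∑ j ∈ Finset.range k,
      (Complex.exp (t * μ) * (t : ℂ) ^ j) • ((j.factorial : ℂ)⁻¹ • (N ^ j * x)) := by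
    have hnil : ((t : ℂ) • N) ^ k * x = 0 := by rw [smul_pow, smul_mul_assoc, h, smul_zero]
    rw [exp_smul_eq_exp_smul_exp_smul_sub_algebraMap a μ, ← hN, smul_mul_assoc,
      exp_mul_eq_sum_of_pow_mul_eq_zero hnil, Finset.smul_sum]
    refine Finset.sum_congr rfl fun j _ ↦ ?_
    rw [smul_pow, smul_mul_assoc, smul_comm _ ((t : ℂ) ^ j), smul_smul]
  simp only [hexpand]
  rw [← Finset.sum_const_zero (s := Finset.range k)]
  refine tendsto_finsetSum _ fun j _ ↦ ?_
  rw [← zero_smul ℂ ((j.factorial : ℂ)⁻¹ • (N ^ j * x))]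
  exact (tendsto_exp_mul_mul_pow_of_re_neg hμ j).smul_const _

theorem mem_spectrum_of_sub_algebraMap_pow_mul_eq_zero {a x : 𝔸} {μ : ℂ} {k : ℕ}
    (hx : x ≠ 0) (h : (a - algebraMap ℂ 𝔸 μ) ^ k * x = 0) : μ ∈ spectrum ℂ a := by
  rw [spectrum.mem_iff, ← IsUnit.neg_iff, neg_sub]
  exact fun hu ↦ hx ((hu.pow k).mul_right_eq_zero.1 h)

/-- The generalized eigenspaces of left multiplication by `a` exhaust the algebra, and on each of
them `exp (t • a)` acts as a decaying exponential times a polynomial in `t`. -/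
theorem tendsto_exp_smul_of_spectrum_re_neg [FiniteDimensional ℂ 𝔸] {a : 𝔸}
    (ha : ∀ μ ∈ spectrum ℂ a, μ.re < 0) :
    Tendsto (fun t : ℝ ↦ exp ((t : ℂ) • a)) atTop (𝓝 0) := by
  have := FiniteDimensional.complete ℂ 𝔸
  suffices hmul : ∀ x : 𝔸, Tendsto (fun t : ℝ ↦ exp ((t : ℂ) • a) * x) atTop (𝓝 0) by
    simpa using hmul 1
  intro x
  have hx : x ∈ ⨆ μ, Module.End.maxGenEigenspace (LinearMap.mulLeft ℂ a) μ := by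
    rw [Module.End.iSup_maxGenEigenspace_eq_top]
    trivial
  induction hx using Submodule.iSup_induction' with
  | mem μ x hx =>
    obtain ⟨k, hk⟩ := (Module.End.mem_maxGenEigenspace _ _ _).1 hx
    have hsub : LinearMap.mulLeft ℂ a - μ • 1 = LinearMap.mulLeft ℂ (a - algebraMap ℂ 𝔸 μ) := by
      ext y
      simp [sub_mul, Algebra.smul_def]
    rw [hsub, LinearMap.pow_mulLeft, LinearMap.mulLeft_apply] at hk
    rcases eq_or_ne x 0 with rfl | hx0
    · simp
    · exact tendsto_exp_smul_mul_of_pow_sub_algebraMap_mul_eq_zero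
        (ha μ (mem_spectrum_of_sub_algebraMap_pow_mul_eq_zero hx0 hk)) hk
  | zero => simp
  | add x y _ _ hx hy => simpa [mul_add] using hx.add hy

end Complex

end BanachAlgebra

section Stability

open Filter Topology NormedSpace MeasureTheory
open scoped Matrix.Norms.Operator

variable {n m p : ℕ} {A : Matrix (Fin n) (Fin n) ℝ}

theorem IsHurwitz.transpose (hA : IsHurwitz A) : IsHurwitz Aᵀ := by
  simpa only [IsHurwitz, Matrix.mem_spectrum_iff_isRoot_charpoly, Matrix.transpose_map,
    Matrix.charpoly_transpose] using hA

theorem IsHurwitz.tendsto_exp (hA : IsHurwitz A) :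
    Tendsto (fun t : ℝ ↦ exp (t • A)) atTop (𝓝 0) := by
  have hre : Continuous fun M : Matrix (Fin n) (Fin n) ℂ ↦ M.map Complex.re :=
    continuous_id.matrix_map Complex.continuous_re
  have hlim := (hre.tendsto 0).comp (tendsto_exp_smul_of_spectrum_re_neg hA)
  rw [Matrix.map_zero _ Complex.zero_re] at hlim
  refine hlim.congr fun t ↦ ?_
  have hsmul : (t : ℂ) • A.map (algebraMap ℝ ℂ) = (algebraMap ℝ ℂ).mapMatrix (t • A) := by
    ext
    simp
  have hmap : Continuous ((algebraMap ℝ ℂ).mapMatrix (m := Fin n)) :=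
    continuous_id.matrix_map Complex.continuous_ofReal
  rw [Function.comp_apply, hsmul, ← map_exp _ hmap]
  exact Matrix.ext fun i j ↦ Complex.ofReal_re _

theorem IsHurwitz.eq_zero_of_mul_add_mul_eq_zero {A' D : Matrix (Fin n) (Fin n) ℝ}
    (hA : IsHurwitz A) (hA' : IsHurwitz A') (h : A * D + D * A' = 0) : D = 0 :=
  eq_zero_of_mul_add_mul_eq_zero_of_tendsto_exp hA.tendsto_exp hA'.tendsto_exp h

theorem impulseEnergy_nonneg (A : Matrix (Fin n) (Fin n) ℝ) (B : Matrix (Fin n) (Fin m) ℝ)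
    (C : Matrix (Fin p) (Fin n) ℝ) (t : ℝ) : 0 ≤ impulseEnergy A B C t := by
  have := (Matrix.posSemidef_conjTranspose_mul_self (C * exp (t • A) * B)).trace_nonneg
  rwa [Matrix.conjTranspose_eq_transpose_of_trivial] at this

theorem hasDerivAt_trace_of_lyapunov {P : Matrix (Fin n) (Fin n) ℝ}
    {C : Matrix (Fin p) (Fin n) ℝ} (B : Matrix (Fin n) (Fin m) ℝ)
    (h : Aᵀ * P + P * A = -(Cᵀ * C)) (t : ℝ) :
    HasDerivAt (fun t : ℝ ↦ (exp (t • Aᵀ) * P * exp (t • A) * (B * Bᵀ)).trace)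
      (-impulseEnergy A B C t) t := by
  have hderiv := (hasDerivAt_exp_smul_mul_mul_exp_smul Aᵀ A P t).mul_const (B * Bᵀ)
  rw [h] at hderiv
  have henergy : -impulseEnergy A B C t =
      (exp (t • Aᵀ) * -(Cᵀ * C) * exp (t • A) * (B * Bᵀ)).trace := by
    rw [← Matrix.transpose_smul, Matrix.exp_transpose, ← Matrix.mul_assoc _ B,
      Matrix.trace_mul_comm, impulseEnergy, ← Matrix.trace_neg]
    simp only [Matrix.transpose_mul, Matrix.mul_assoc, Matrix.neg_mul, Matrix.mul_neg]
  rw [henergy]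
  exact (Matrix.traceLinearMap (Fin n) ℝ ℝ).toContinuousLinearMap.hasFDerivAt.comp_hasDerivAt t
    hderiv

theorem IsHurwitz.hasH2Norm_of_lyapunov (hA : IsHurwitz A) {P : Matrix (Fin n) (Fin n) ℝ}
    {C : Matrix (Fin p) (Fin n) ℝ} (B : Matrix (Fin n) (Fin m) ℝ)
    (h : Aᵀ * P + P * A = -(Cᵀ * C)) : HasH2Norm A B C (√(Bᵀ * P * B).trace) := by
  have hlim : Tendsto (fun t : ℝ ↦ (exp (t • Aᵀ) * P * exp (t • A) * (B * Bᵀ)).trace)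
      atTop (𝓝 0) := by
    have hmul := ((hA.transpose.tendsto_exp.mul_const P).mul hA.tendsto_exp).mul_const (B * Bᵀ)
    have htrace : Continuous (Matrix.trace : Matrix (Fin n) (Fin n) ℝ → ℝ) :=
      continuous_id.matrix_trace
    simpa [Function.comp_def] using (htrace.tendsto _).comp hmul
  have hderiv := fun t (_ : t ∈ Set.Ici 0) ↦ hasDerivAt_trace_of_lyapunov B h t
  have hnonpos := fun t (_ : t ∈ Set.Ioi 0) ↦ neg_nonpos.2 (impulseEnergy_nonneg A B C t)
  refine ⟨hA, by simpa using (integrableOn_Ioi_deriv_of_nonpos' hderiv hnonpos hlim).neg, ?_⟩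
  have hintegral := integral_Ioi_of_hasDerivAt_of_nonpos' hderiv hnonpos hlim
  rw [integral_neg, zero_sub, neg_inj] at hintegral
  rw [hintegral, Matrix.mul_assoc, Matrix.trace_mul_comm]
  simp [Matrix.mul_assoc]

end Stability

section Detectability

open scoped ComplexOrder

variable {n p : ℕ}

/-- Detectability of the pair `(C, A)`, in the form of the Hautus test: no eigenvector of `A` for an
eigenvalue in the closed right half-plane lies in the kernel of `C`. It is what makes a positive
semidefinite solution of a Lyapunov equation certify stability. -/
def IsDetectable (A : Matrix (Fin n) (Fin n) ℝ) (C : Matrix (Fin p) (Fin n) ℝ) : Prop :=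
  ∀ (μ : ℂ) (v : Fin n → ℂ), 0 ≤ μ.re → A.map (algebraMap ℝ ℂ) *ᵥ v = μ • v →
    C.map (algebraMap ℝ ℂ) *ᵥ v = 0 → v = 0

theorem conjTranspose_map_algebraMap_complex {m n : Type*} (M : Matrix m n ℝ) :
    (M.map (algebraMap ℝ ℂ))ᴴ = Mᵀ.map (algebraMap ℝ ℂ) :=
  Matrix.ext fun _ _ ↦ Complex.conj_ofReal _

theorem posSemidef_map_algebraMap_complex {n : Type*} [Finite n] {P : Matrix n n ℝ}
    (hP : P.PosSemidef) : (P.map (algebraMap ℝ ℂ)).PosSemidef := by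
  classical
  cases nonempty_fintype n
  open scoped MatrixOrder in
  obtain ⟨R, rfl⟩ := CStarAlgebra.nonneg_iff_eq_star_mul_self.1 hP.nonneg
  rw [Matrix.star_eq_conjTranspose, Matrix.conjTranspose_eq_transpose_of_trivial, Matrix.map_mul,
    ← conjTranspose_map_algebraMap_complex]
  exact Matrix.posSemidef_conjTranspose_mul_self _

/-- Testing the Lyapunov equation on `v` gives `2 (re μ) v* P v = -|C v|²`. -/
theorem mulVec_eq_zero_of_lyapunov {n p : Type*} [Fintype n] [Fintype p] {A P : Matrix n n ℂ}
    {C : Matrix p n ℂ} (hP : P.PosSemidef) (h : Aᴴ * P + P * A = -(Cᴴ * C)) {μ : ℂ}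
    {v : n → ℂ} (hμ : 0 ≤ μ.re) (hv : A *ᵥ v = μ • v) : C *ᵥ v = 0 := by
  have htest : (star μ + μ) * (star v ⬝ᵥ P *ᵥ v) = -(star (C *ᵥ v) ⬝ᵥ C *ᵥ v) := by
    have := congrArg (fun M ↦ star v ⬝ᵥ M *ᵥ v) h
    simp only [Matrix.add_mulVec, Matrix.neg_mulVec, dotProduct_add, dotProduct_neg,
      ← Matrix.mulVec_mulVec, hv, Matrix.mulVec_smul, dotProduct_smul] at this
    simp only [Matrix.dotProduct_mulVec (star v) _ᴴ, ← Matrix.star_mulVec, hv, star_smul,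
      smul_dotProduct, smul_eq_mul] at this
    rw [add_mul, this]
  have hre : 0 ≤ star μ + μ := by
    rw [add_comm, Complex.star_def, Complex.add_conj]
    exact_mod_cast mul_nonneg zero_le_two hμ
  refine dotProduct_star_self_eq_zero.1 (le_antisymm ?_ (dotProduct_star_self_nonneg _))
  rw [← neg_nonneg, ← htest]
  exact mul_nonneg hre (hP.dotProduct_mulVec_nonneg v)

theorem IsDetectable.isHurwitz_of_lyapunov {A P : Matrix (Fin n) (Fin n) ℝ}
    {C : Matrix (Fin p) (Fin n) ℝ} (hAC : IsDetectable A C) (hP : P.PosSemidef)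
    (h : Aᵀ * P + P * A = -(Cᵀ * C)) : IsHurwitz A := by
  intro μ hμ
  by_contra! hre
  rw [← Matrix.spectrum_toLin', ← Module.End.hasEigenvalue_iff_mem_spectrum] at hμ
  obtain ⟨v, hv⟩ := hμ.exists_hasEigenvector
  have hAv : A.map (algebraMap ℝ ℂ) *ᵥ v = μ • v := by simpa using hv.apply_eq_smul
  have hlyap : (A.map (algebraMap ℝ ℂ))ᴴ * P.map (algebraMap ℝ ℂ) +
      P.map (algebraMap ℝ ℂ) * A.map (algebraMap ℝ ℂ) =
        -((C.map (algebraMap ℝ ℂ))ᴴ * C.map (algebraMap ℝ ℂ)) := by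
    rw [conjTranspose_map_algebraMap_complex, conjTranspose_map_algebraMap_complex,
      ← Matrix.map_mul, ← Matrix.map_mul, ← Matrix.map_mul, ← Matrix.map_add _ (map_add _), h,
      Matrix.map_neg _ (map_neg _)]
  exact hv.2 (hAC μ v hre hAv
    (mulVec_eq_zero_of_lyapunov (posSemidef_map_algebraMap_complex hP) hlyap hre hAv))

end Detectability

namespace Plant

variable {n : ℕ} {G : Plant n} {P : Matrix (Fin n) (Fin n) ℝ}

theorem closedLoopC_transpose_mul_self (P : Matrix (Fin n) (Fin n) ℝ) :
    (G.closedLoopC P)ᵀ * G.closedLoopC P =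
      G.w ^ 2 • (G.Cᵀ * G.C) + (G.Bᵀ * P)ᵀ * (G.Bᵀ * P) := by
  ext i j
  simp only [closedLoopC, Matrix.mul_apply, Fin.sum_univ_two, Matrix.transpose_apply,
    Matrix.of_apply, Matrix.add_apply, Matrix.smul_apply, Finset.univ_unique,
    Finset.sum_singleton, Matrix.cons_val_zero, Matrix.cons_val_one, smul_eq_mul,
    Fin.default_eq_zero, Matrix.neg_apply]
  ring

/-- Where both components of the performance output `(w y, u)` vanish, the feedback is inactive and
the closed loop agrees with the plant. -/
theorem isDetectable_closedLoop (hG : IsDetectable G.A G.C) (hw : G.w ≠ 0)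
    (P : Matrix (Fin n) (Fin n) ℝ) : IsDetectable (G.closedLoopA P) (G.closedLoopC P) := by
  intro μ v hμ hA hC
  have houtput : (G.closedLoopC P).map (algebraMap ℝ ℂ) *ᵥ v =
      ![G.w * (G.C.map (algebraMap ℝ ℂ) *ᵥ v) 0,
        -((G.Bᵀ * P).map (algebraMap ℝ ℂ) *ᵥ v) 0] := by
    ext i
    fin_cases i <;> simp [closedLoopC, Matrix.mulVec, dotProduct, mul_assoc, Finset.mul_sum]
  rw [houtput] at hC
  have hy : G.C.map (algebraMap ℝ ℂ) *ᵥ v = 0 :=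
    funext <| Unique.forall_iff.2 <|
      (mul_eq_zero.1 (congrFun hC 0)).resolve_left (Complex.ofReal_ne_zero.2 hw)
  have hu : (G.Bᵀ * P).map (algebraMap ℝ ℂ) *ᵥ v = 0 :=
    funext <| Unique.forall_iff.2 <| neg_eq_zero.1 (congrFun hC 1)
  rw [closedLoopA, Matrix.map_sub _ (map_sub _), Matrix.map_mul, Matrix.sub_mulVec,
    ← Matrix.mulVec_mulVec, hu, Matrix.mulVec_zero, sub_zero] at hA
  exact hG μ v hμ hA hy

theorem isRiccatiSolution_of_gain {K : Matrix (Fin 1) (Fin n) ℝ} (hP : P.PosSemidef)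
    (hK : G.Bᵀ * P = K)
    (h : G.Aᵀ * P + P * G.A - Kᵀ * K + G.w ^ 2 • (G.Cᵀ * G.C) = 0) : G.IsRiccatiSolution P := by
  have hPB : P * G.B = Kᵀ := by
    rw [← hK, Matrix.transpose_mul, Matrix.transpose_transpose,
      ← Matrix.conjTranspose_eq_transpose_of_trivial P, hP.isHermitian.eq]
  exact ⟨hP, by rwa [hPB, Matrix.mul_assoc, hK]⟩

namespace IsRiccatiSolution

variable {P' : Matrix (Fin n) (Fin n) ℝ}

theorem transpose_eq (h : G.IsRiccatiSolution P) : Pᵀ = P := by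
  rw [← Matrix.conjTranspose_eq_transpose_of_trivial, h.1.isHermitian.eq]

theorem lyapunov (h : G.IsRiccatiSolution P) :
    (G.closedLoopA P)ᵀ * P + P * G.closedLoopA P = -((G.closedLoopC P)ᵀ * G.closedLoopC P) := by
  rw [closedLoopC_transpose_mul_self, eq_neg_iff_add_eq_zero, ← h.2]
  simp only [closedLoopA, Matrix.transpose_sub, Matrix.transpose_mul, Matrix.transpose_transpose,
    h.transpose_eq, Matrix.sub_mul, Matrix.mul_sub, Matrix.mul_assoc]
  abel

theorem isHurwitz (h : G.IsRiccatiSolution P) (hG : IsDetectable G.A G.C) (hw : G.w ≠ 0) :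
    IsHurwitz (G.closedLoopA P) :=
  (isDetectable_closedLoop hG hw P).isHurwitz_of_lyapunov h.1 h.lyapunov

theorem sylvester (h : G.IsRiccatiSolution P) (h' : G.IsRiccatiSolution P') :
    (G.closedLoopA P')ᵀ * (P' - P) + (P' - P) * G.closedLoopA P = 0 := by
  rw [← sub_self (0 : Matrix (Fin n) (Fin n) ℝ)]
  nth_rw 1 [← h'.2]
  rw [← h.2]
  simp only [closedLoopA, Matrix.transpose_sub, Matrix.transpose_mul, Matrix.transpose_transpose,
    h'.transpose_eq, Matrix.sub_mul, Matrix.mul_sub, Matrix.mul_assoc]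
  abel

theorem unique (h : G.IsRiccatiSolution P) (h' : G.IsRiccatiSolution P') (hG : IsDetectable G.A G.C)
    (hw : G.w ≠ 0) : P' = P :=
  sub_eq_zero.1 ((h'.isHurwitz hG hw).transpose.eq_zero_of_mul_add_mul_eq_zero
    (h.isHurwitz hG hw) (h.sylvester h'))

theorem hasLQRH2Norm (h : G.IsRiccatiSolution P) (hG : IsDetectable G.A G.C) (hw : G.w ≠ 0) :
    G.HasLQRH2Norm (√(G.Bᵀ * P * G.B).trace) :=
  ⟨P, h, fun _ h' ↦ h.unique h' hG hw, (h.isHurwitz hG hw).hasH2Norm_of_lyapunov G.B h.lyapunov⟩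

end IsRiccatiSolution

end Plant

section Integrators

/-- The double integrator `y'' = u` with output `y`. -/
def doubleIntegrator (w : ℝ) : Plant 2 where
  A := !![0, 1; 0, 0]
  B := !![0; 1]
  C := !![1, 0]
  w := w

/-- Two double integrators in series with gain `γ`, the input reaching the second one directly with
gain `α`: `y'' = γ θ + α u` and `θ'' = u`, with state `(y, y', θ, θ')` and output `y`. -/
def quadrupleIntegrator (γ α w : ℝ) : Plant 4 where
  A := !![0, 1, 0, 0; 0, 0, γ, 0; 0, 0, 0, 1; 0, 0, 0, 0]
  B := !![0; α; 0; 1]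
  C := !![1, 0, 0, 0]
  w := w

theorem isDetectable_doubleIntegrator (w : ℝ) :
    IsDetectable (doubleIntegrator w).A (doubleIntegrator w).C := by
  intro μ v _ hA hC
  have h0 : v 0 = 0 := by
    simpa [doubleIntegrator, Matrix.mulVec, dotProduct, Fin.sum_univ_succ] using congrFun hC 0
  have h1 : v 1 = 0 := by
    simpa [doubleIntegrator, Matrix.mulVec, dotProduct, Fin.sum_univ_succ, h0] using congrFun hA 0
  funext i
  fin_cases i <;> assumption

theorem isDetectable_quadrupleIntegrator {γ : ℝ} (hγ : γ ≠ 0) (α w : ℝ) :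
    IsDetectable (quadrupleIntegrator γ α w).A (quadrupleIntegrator γ α w).C := by
  intro μ v _ hA hC
  simp only [quadrupleIntegrator] at hA hC
  have h0 : v 0 = 0 := by
    simpa [Matrix.mulVec, dotProduct, Fin.sum_univ_succ] using congrFun hC 0
  have h1 : v 1 = 0 := by
    simpa [Matrix.mulVec, dotProduct, Fin.sum_univ_succ, h0] using congrFun hA 0
  have h2 : v 2 = 0 := by
    simpa [Matrix.mulVec, dotProduct, Fin.sum_univ_succ, h1, hγ] using congrFun hA 1
  have h3 : v 3 = 0 := by
    simpa [Matrix.mulVec, dotProduct, Fin.sum_univ_succ, h2] using congrFun hA 2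
  funext i
  fin_cases i <;> assumption

theorem doubleIntegrator_hasLQRH2Norm {w : ℝ} (hw : 0 < w) :
    (doubleIntegrator w).HasLQRH2Norm (√(√(2 * w))) := by
  set x := √(2 * w)
  have hx2 : x ^ 2 = 2 * w := Real.sq_sqrt (by positivity)
  have hP : (!![w * x, w; w, x] : Matrix (Fin 2) (Fin 2) ℝ).PosSemidef := by
    have hfactor : !![w * x, w; w, x] = (x / 2) • (!![x, 1; 0, 1]ᴴ * !![x, 1; 0, 1]) := by
      rw [show w = x ^ 2 / 2 by linarith]
      ext i j
      fin_cases i <;> fin_cases j <;> simp [Matrix.mul_apply] <;> ring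
    rw [hfactor]
    exact (Matrix.posSemidef_conjTranspose_mul_self _).smul (half_pos (by positivity : 0 < x)).le
  have hK : (doubleIntegrator w).Bᵀ * !![w * x, w; w, x] = !![w, x] := by
    ext i j
    fin_cases i; fin_cases j <;> simp [doubleIntegrator, Matrix.mul_apply]
  have hR : (doubleIntegrator w).IsRiccatiSolution !![w * x, w; w, x] := by
    refine Plant.isRiccatiSolution_of_gain hP hK ?_
    ext i j
    fin_cases i <;> fin_cases j <;>
      simp [doubleIntegrator, Matrix.mul_apply, Fin.sum_univ_succ] <;> linarith
  convert hR.hasLQRH2Norm (isDetectable_doubleIntegrator w) hw.ne'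
  rw [hK]
  simp [doubleIntegrator]

/-- The stabilizing Riccati solution of `quadrupleIntegrator γ α w`, where `κ = ± w` and `r`, `u`
are the positive solutions of `r² u² = 2 κ γ` and `u² + 2 u r - r² = 2 κ α`. The closed-loop
characteristic polynomial is then `(s² + c s + d) (s² + c̄ s + d̄)` with
`c = ((r + u) + i (r - u)) / 2` and `d = r u (1 + i) / 2`. -/
noncomputable def quadrupleRiccati (κ r u : ℝ) : Matrix (Fin 4) (Fin 4) ℝ :=
  !![2 * κ ^ 2 / u, 2 * κ ^ 2 / u ^ 2, κ * r * (r - u) / u, κ * r * (r - 2 * u) / u ^ 2;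
    2 * κ ^ 2 / u ^ 2, 2 * κ ^ 2 * (r + u) / (r * u ^ 3), κ * r ^ 2 / u ^ 2,
      κ * (r ^ 3 - u * r ^ 2 - u ^ 2 * r - u ^ 3) / (r * u ^ 3);
    κ * r * (r - u) / u, κ * r ^ 2 / u ^ 2,
      r * (r ^ 3 - r ^ 2 * u + u ^ 2 * r + u ^ 3) / (2 * u), r ^ 2 * (r - u) ^ 2 / (2 * u ^ 2);
    κ * r * (r - 2 * u) / u ^ 2, κ * (r ^ 3 - u * r ^ 2 - u ^ 2 * r - u ^ 3) / (r * u ^ 3),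
      r ^ 2 * (r - u) ^ 2 / (2 * u ^ 2),
      (u ^ 5 + 3 * u ^ 4 * r + 2 * u ^ 2 * r ^ 3 - 3 * u * r ^ 4 + r ^ 5) / (2 * r * u ^ 3)]

/-- The unnormalized upper triangular Cholesky factor of `quadrupleRiccati κ r u`, with which its
positive semidefiniteness is checked. -/
noncomputable def quadrupleRiccatiFactor (κ r u : ℝ) : Matrix (Fin 4) (Fin 4) ℝ :=
  !![κ, κ / u, r * (r - u) / 2, r * (r - 2 * u) / (2 * u);
    0, κ, r ^ 2 * u / 2, (r ^ 2 - u * r - u ^ 2) / 2;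
    0, 0, 1, 1 / u;
    0, 0, 0, 1]

variable {κ r u γ α w : ℝ}

theorem quadrupleRiccati_eq_transpose_mul_diagonal_mul (κ : ℝ) (hr : r ≠ 0) (hu : u ≠ 0) :
    quadrupleRiccati κ r u = (quadrupleRiccatiFactor κ r u)ᵀ *
      Matrix.diagonal ![2 / u, 2 / (r * u ^ 2), r * u ^ 2 / 2, u / 2] *
        quadrupleRiccatiFactor κ r u := by
  ext i j
  fin_cases i <;> fin_cases j <;>
    simp [quadrupleRiccati, quadrupleRiccatiFactor, Matrix.mul_apply, Fin.sum_univ_succ,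
      Matrix.diagonal] <;>
    field_simp <;> ring

theorem posSemidef_quadrupleRiccati (κ : ℝ) (hr : 0 < r) (hu : 0 < u) :
    (quadrupleRiccati κ r u).PosSemidef := by
  have hD : (Matrix.diagonal ![2 / u, 2 / (r * u ^ 2), r * u ^ 2 / 2, u / 2]).PosSemidef := by
    refine Matrix.posSemidef_diagonal_iff.2 fun i ↦ ?_
    fin_cases i <;> simp only [Fin.zero_eta, Fin.mk_one, Fin.reduceFinMk, Matrix.cons_val] <;>
      positivity
  rw [quadrupleRiccati_eq_transpose_mul_diagonal_mul κ hr.ne' hu.ne',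
    ← Matrix.conjTranspose_eq_transpose_of_trivial]
  exact hD.conjTranspose_mul_mul_same _

theorem quadrupleIntegrator_gain (w : ℝ) (hκ : κ ≠ 0) (hr : r ≠ 0) (hu : u ≠ 0)
    (hα : 2 * κ * α = u ^ 2 + 2 * u * r - r ^ 2) :
    (quadrupleIntegrator γ α w).Bᵀ * quadrupleRiccati κ r u =
      !![κ, 2 * κ / u, r ^ 2, r * (r - u) / u] := by
  obtain rfl : α = (u ^ 2 + 2 * u * r - r ^ 2) / (2 * κ) := by field_simp; linarith
  ext i j
  fin_cases i; fin_cases j <;>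
    simp [quadrupleIntegrator, quadrupleRiccati, Matrix.mul_apply, Fin.sum_univ_succ] <;>
    field_simp <;> ring

theorem quadrupleIntegrator_isRiccatiSolution (hκ : κ ≠ 0) (hr : 0 < r) (hu : 0 < u)
    (hγ : 2 * κ * γ = r ^ 2 * u ^ 2) (hα : 2 * κ * α = u ^ 2 + 2 * u * r - r ^ 2)
    (hw : w ^ 2 = κ ^ 2) :
    (quadrupleIntegrator γ α w).IsRiccatiSolution (quadrupleRiccati κ r u) := by
  refine Plant.isRiccatiSolution_of_gain (posSemidef_quadrupleRiccati κ hr hu)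
    (quadrupleIntegrator_gain w hκ hr.ne' hu.ne' hα) ?_
  obtain rfl : γ = r ^ 2 * u ^ 2 / (2 * κ) := by field_simp; linarith
  ext i j
  fin_cases i <;> fin_cases j <;>
    simp [quadrupleIntegrator, quadrupleRiccati, Matrix.mul_apply, Fin.sum_univ_succ, hw] <;>
    field_simp <;> ring

theorem quadrupleIntegrator_hasLQRH2Norm_sqrt_add (hκ : κ ≠ 0) (hr : 0 < r) (hu : 0 < u)
    (hγ : 2 * κ * γ = r ^ 2 * u ^ 2) (hα : 2 * κ * α = u ^ 2 + 2 * u * r - r ^ 2)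
    (hw : w ^ 2 = κ ^ 2) : (quadrupleIntegrator γ α w).HasLQRH2Norm (√(r + u)) := by
  have hw0 : w ≠ 0 := by
    rintro rfl
    exact hκ (by simpa using hw.symm)
  have hγ0 : γ ≠ 0 := by
    rintro rfl
    exact (by positivity : r ^ 2 * u ^ 2 ≠ 0) (by linarith)
  convert (quadrupleIntegrator_isRiccatiSolution hκ hr hu hγ hα hw).hasLQRH2Norm
    (isDetectable_quadrupleIntegrator hγ0 α w) hw0 using 2
  rw [quadrupleIntegrator_gain w hκ hr.ne' hu.ne' hα]
  simp [quadrupleIntegrator]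
  field_simp
  linear_combination -hα

theorem exists_pos_mul_sq_eq_of_eq_sqrt {a b q σ : ℝ} (ha : 0 < a) (hq : 0 < q)
    (hσ : σ = √((a - b) ^ 2 + a ^ 2)) :
    ∃ r u, 0 < r ∧ 0 < u ∧ q ^ 3 * r ^ 2 = σ + (a - b) ∧ q ^ 3 * u ^ 2 = σ - (a - b) ∧
      q ^ 3 * (r * u) = a ∧ r + u = (2 * a - b + σ) / (q * √q * √(a - b + σ)) := by
  have hσ2 : σ ^ 2 = (a - b) ^ 2 + a ^ 2 := hσ ▸ Real.sq_sqrt (by positivity)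
  have hτ : 0 < a - b + σ := by
    have : |a - b| < σ := Real.sqrt_sq_eq_abs (a - b) ▸ hσ ▸
      Real.sqrt_lt_sqrt (sq_nonneg _) (lt_add_of_pos_right _ (by positivity))
    linarith [neg_abs_le (a - b)]
  have hr2 : q ^ 3 * (√(a - b + σ) / (q * √q)) ^ 2 = σ + (a - b) := by
    rw [div_pow, mul_pow, Real.sq_sqrt hτ.le, Real.sq_sqrt hq.le]
    field_simp
    ring
  have hru : q ^ 3 * (√(a - b + σ) / (q * √q) * (a / (q * √q * √(a - b + σ)))) = a := by
    field_simp
    rw [Real.sq_sqrt hq.le]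
  refine ⟨√(a - b + σ) / (q * √q), a / (q * √q * √(a - b + σ)), by positivity, by positivity,
    hr2, mul_left_cancel₀ hτ.ne' ?_, hru, ?_⟩
  · linear_combination -hσ2 - q ^ 3 * (a / (q * √q * √(a - b + σ))) ^ 2 * hr2 +
      (q ^ 3 * (√(a - b + σ) / (q * √q) * (a / (q * √q * √(a - b + σ)))) + a) * hru
  · field_simp
    rw [Real.sq_sqrt hτ.le]
    ring

/-- The sign `ε` covers the two horizontal directions. -/
theorem quadrupleIntegrator_hasLQRH2Norm {g q ε : ℝ} (α : ℝ) (hg : 0 < g) (hq : 0 < q)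
    (hε : ε ^ 2 = 1) {a b σ : ℝ} (ha : a = √(2 * g * q ^ 7)) (hb : b = α * q ^ 4)
    (hσ : σ = √((a - b) ^ 2 + a ^ 2)) :
    (quadrupleIntegrator (ε * g) (ε * α) q).HasLQRH2Norm
      (√((2 * a - b + σ) / (q * √q * √(a - b + σ)))) := by
  have ha0 : 0 < a := ha ▸ by positivity
  have ha2 : a ^ 2 = 2 * g * q ^ 7 := ha ▸ Real.sq_sqrt (by positivity)
  obtain ⟨r, u, hr, hu, hr2, hu2, hru, hsum⟩ := exists_pos_mul_sq_eq_of_eq_sqrt ha0 hq hσ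
  have hεq : (ε * q) ^ 2 = q ^ 2 := by rw [mul_pow, hε, one_mul]
  have hγ : 2 * (ε * q) * (ε * g) = r ^ 2 * u ^ 2 := by
    refine mul_left_cancel₀ (pow_ne_zero 6 hq.ne') ?_
    linear_combination 2 * g * q ^ 7 * hε - ha2 - (q ^ 3 * (r * u) + a) * hru
  have hα : 2 * (ε * q) * (ε * α) = u ^ 2 + 2 * u * r - r ^ 2 := by
    refine mul_left_cancel₀ (pow_ne_zero 3 hq.ne') ?_
    linear_combination 2 * q ^ 4 * α * hε - 2 * hb + hr2 - 2 * hru - hu2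
  rw [← hsum]
  exact quadrupleIntegrator_hasLQRH2Norm_sqrt_add
    (pow_ne_zero_iff two_ne_zero |>.1 (hεq ▸ by positivity)) hr hu hγ hα hεq.symm

end Integrators

namespace Params

theorem inputScale_pos (S : Params) (i : Fin 4) : 0 < S.inputScale i := by
  have := S.mPL_nonneg
  have := S.mUAV_pos
  have := S.Hxx_pos
  have := S.Hyy_pos
  have := S.Hzz_pos
  have hm : 0 < S.mtot := by unfold mtot; positivity
  unfold inputScale
  fin_cases i <;> simp only [Fin.zero_eta, Fin.mk_one, Fin.reduceFinMk, Matrix.cons_val] <;>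
    positivity

theorem qhat_pos (S : Params) (i : Fin 4) : 0 < S.qhat i :=
  mul_pos (S.inputScale_pos i) (S.q_pos i)

end Params

end UAVPayload
theorem mainTheorem2 (S : UAVPayload.Params) :
    (UAVPayload.subsystem1 S).HasLQRH2Norm
      (√((2 * S.a 0 - S.b 0 + S.sigma 0) /
        (S.qhat 0 * √(S.qhat 0) * √(S.a 0 - S.b 0 + S.sigma 0)))) ∧
    (UAVPayload.subsystem2 S).HasLQRH2Norm
      (√((2 * S.a 1 - S.b 1 + S.sigma 1) /
        (S.qhat 1 * √(S.qhat 1) * √(S.a 1 - S.b 1 + S.sigma 1)))) ∧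
    (UAVPayload.subsystem3 S).HasLQRH2Norm (√(√(2 * S.qhat 2))) ∧
    (UAVPayload.subsystem4 S).HasLQRH2Norm (√(√(2 * S.qhat 3))) := by
  refine ⟨?_, ?_, UAVPayload.doubleIntegrator_hasLQRH2Norm (S.qhat_pos 2),
    UAVPayload.doubleIntegrator_hasLQRH2Norm (S.qhat_pos 3)⟩
  · have h := UAVPayload.quadrupleIntegrator_hasLQRH2Norm (ε := 1) (a := S.a 0) (b := S.b 0)
      (σ := S.sigma 0) S.alpha S.g_pos (S.qhat_pos 0) (one_pow 2) rfl rfl rfl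
    rwa [one_mul, one_mul] at h
  · have h := UAVPayload.quadrupleIntegrator_hasLQRH2Norm (ε := -1) (a := S.a 1) (b := S.b 1)
      (σ := S.sigma 1) S.alpha S.g_pos (S.qhat_pos 1) (neg_one_sq) rfl rfl rfl
    rwa [neg_one_mul, neg_one_mul] at h
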